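/- Let $H$ be a real Hilbert space, $T>0$, $\rho\in\,]0,+\infty]$ (with $\tfrac1{2\rho}:=0$ if $\rho=+\infty$), and let $C\colon[0,T]\rightrightarrows H$ be a set-valued map. *Notions.* For $S\subset H$ and $x\in S$, the proximal normal cone $N^P(S;x)$ is the set of $\zeta\in H$ for which there are $\sigma\ge 0$ and $\eta>0$ with $\langle\zeta,y-x\rangle\le\sigma\|y-x\|^2$ for all $y\in S$ with $\|y-x\|<\eta$. A nonempty closed set $S$ is $\rho$-uniformly prox-regular if $\langle\zeta,x'-x\rangle\le\frac{\|\zeta\|}{2\rho}\|x'-x\|^2$ for all $x,x'\in S$ and $\zeta\in N^P(S;x)$. A complete positive Radon measure on $[0,T]$ is a finite complete measure on a $\sigma$-algebra containing the Borel sets, for which the measure of every measurable set is the supremum of the measures of its compact subsets. A map $x\colon[0,T]\to H$ is an admissible trajectory for $C$ (with initial point $x_0\in C(0)$) if it is right-continuous and of bounded variation, $x(0)=x_0$, and $x(t)\in C(t)$ for all $t\in[0,T]$. Its differential measure $dx$ is the $H$-valued Borel measure on $[0,T]$ with $dx(]s,t])=x(t)-x(s)$ for $0\le s\le t\le T$ and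 $dx(\{0\})=0$; $dx\ll\nu$ means that $dx$ vanishes on $\nu$-null Borel sets, and $\frac{dx}{d\nu}\in L^1_\nu([0,T];H)$ is the Radon–Nikodým density. *Assumptions.* - (H1) For all $t\in[0,T]$ the set $C(t)$ is nonempty, closed, connected and $\rho$-uniformly prox-regular. - (H2) $C$ is lower semicontinuous on $[0,T]$. - (H3) For every bounded $x\colon[0,T]\to H$ with $x(t)\in C(t)$ for all $t$ and every $\eta>0$ there is $R_{x,\eta}>0$ such that, for every compact $K\subset[0,T]$ and every continuous $y\colon K\to H$ with $y(t)\in C(t)$ and $\|y(t)-x(t)\|\le\eta$ for all $t\in K$, there is a continuous $\bar y\colon[0,T]\to H$ with $\bar y(t)\in C(t)$ for all $t\in[0,T]$, $\bar y=y$ on $K$ and $\sup_{t\in[0,T]}\|\bar y(t)\|\le R_{x,\eta}$. *Solutions and residual.* For a complete positive Radon measure $\nu$ let $\mathcal A_\nu$ be the set of continuous $y\colon[0,T]\to H$ with $y(t)\in C(t)$ for $\nu$-a.e. $t$, and for $x$ of bounded variation and right-continuous with $dx\ll\nu$ and $v:=\frac{dx}{d\nu}$ put $$\mathcal E_\nu(x):=\inf_{y\in\mathcal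 A_\nu}\int_0^T\Big[\langle v(t),y(t)-x(t)\rangle+\frac{\|v(t)\|}{2\rho}\|y(t)-x(t)\|^2\Big]\,d\nu(t)\in[-\infty,+\infty].$$ The map $x$ is an *integral solution* if it is an admissible trajectory and there is a complete positive Radon measure $\mu$ on $[0,T]$ with $dx\ll\mu$, with density $v=\frac{dx}{d\mu}\in L^1_\mu([0,T];H)$, such that $$\int_0^T\Big[\langle v(t),y(t)-x(t)\rangle+\frac{\|v(t)\|}{2\rho}\|y(t)-x(t)\|^2\Big]\,d\mu(t)\ge 0\quad\text{for every }y\in\mathcal A_\mu.$$ It is a *solution in the sense of differential measures* if it is an admissible trajectory and there is a complete positive Radon measure $\mu$ on $[0,T]$ with $dx\ll\mu$, with density $\frac{dx}{d\mu}\in L^1_\mu([0,T];H)$, and $\frac{dx}{d\mu}(t)\in -N^P(C(t);x(t))$ for $\mu$-a.e. $t$. **Theorem.** Assume (H1), (H2) and (H3). Let $x\colon[0,T]\to H$ be an admissible trajectory for $C$ and let $\nu$ be a complete positive Radon measure on $[0,T]$ with $dx\ll\nu$. Then the density $\frac{dx}{d\nu}\in L^1_\nu([0,T];H)$ exists, $\mathcal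 A_\nu\ne\emptyset$, $\mathcal E_\nu(x)\le 0$, and the following assertions are equivalent: 1. $x$ is an integral solution; 2. $x$ is a solution in the sense of differential measures; 3. $\mathcal E_\nu(x)=0$; 4. there is a complete positive Radon measure $\nu'$ on $[0,T]$ with $dx\ll\nu'$ and $\mathcal E_{\nu'}(x)=0$. -/

import Mathlib

open MeasureTheory Set Topology
open scoped ENNReal

set_option linter.unusedSectionVars false

noncomputable section

namespace SweepingProcess

/-! ### Proximal normal cones and prox-regular sets -/

section Prox

variable {H : Type*} [NormedAddCommGroup H] [InnerProductSpace ℝ H]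

open scoped Classical in
/-- The indicator function of convex analysis: `0` on `S` and `+∞` outside `S`. -/
def indicatorFn (S : Set H) (y : H) : EReal := if y ∈ S then 0 else ⊤

/-- The proximal subdifferential of an extended-real-valued function at `x`
(empty if `f x = +∞`). -/
def proxSubdiff (f : H → EReal) (x : H) : Set H :=
  {ζ | f x ≠ ⊤ ∧ ∃ σ : ℝ, 0 ≤ σ ∧ ∃ η : ℝ, 0 < η ∧ ∀ y ∈ Metric.ball x η,
    f x + ((inner ℝ ζ (y - x) - σ * ‖y - x‖ ^ 2 : ℝ) : EReal) ≤ f y}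

/-- The proximal normal cone to `S` at `x`. -/
def proxNormalCone (S : Set H) (x : H) : Set H := proxSubdiff (indicatorFn S) x

/-- The number `1 / (2ρ)` for `ρ ∈ ]0, +∞]`; it is `0` for `ρ = +∞`. -/
def halfInv (ρ : ℝ≥0∞) : ℝ := ((2 * ρ)⁻¹).toReal

/-- `S` is `ρ`-uniformly prox-regular, for `ρ ∈ ]0, +∞]`. -/
def IsProxRegular (ρ : ℝ≥0∞) (S : Set H) : Prop :=
  S.Nonempty ∧ IsClosed S ∧ ∀ x ∈ S, ∀ ζ ∈ proxNormalCone S x, ∀ x' ∈ S,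
    inner ℝ ζ (x' - x) ≤ halfInv ρ * ‖ζ‖ * ‖x' - x‖ ^ 2

end Prox

/-! ### Complete Radon measures on `[0,T]` -/

/-- A complete positive Radon measure on `[0,T]`: a finite complete measure on a `σ`-algebra
containing the Borel sets, for which the measure of every measurable set is the supremum of the
measures of its compact subsets. -/
structure CompleteRadonMeasure (T : ℝ) where
  /-- the `σ`-algebra on which the measure is defined -/
  sigma : MeasurableSpace (Icc (0 : ℝ) T)
  /-- the measure -/
  meas : @Measure (Icc (0 : ℝ) T) sigma
  borel_le : borel (Icc (0 : ℝ) T) ≤ sigma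
  finite : meas univ < ∞
  complete : meas.IsComplete
  innerRegular : meas.InnerRegularWRT IsCompact (fun B => MeasurableSet[sigma] B)

section Sweeping

variable {H : Type*} [NormedAddCommGroup H] [InnerProductSpace ℝ H] {T : ℝ}

/-! ### Differential measures -/

section Differential

instance instCompactIccSpaceTime : CompactIccSpace (Icc (0 : ℝ) T) :=
  ⟨@fun _ _ => isClosed_Icc.isCompact⟩

variable [CompleteSpace H]

/-- The differential measure `dx` of a map `x` of bounded variation on `[0,T]`, as a Borel
`H`-valued measure. If `x` is right-continuous, then `dx ]s,t] = x t - x s` and `dx {0} = 0`. -/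
def differentialMeasure {x : Icc (0 : ℝ) T → H} (hx : BoundedVariationOn x univ) :
    VectorMeasure (Icc (0 : ℝ) T) H :=
  hx.vectorMeasure

theorem differentialMeasure_Ioc {x : Icc (0 : ℝ) T → H} (hx : BoundedVariationOn x univ)
    (hr : ∀ t, ContinuousWithinAt x (Ici t) t) {s t : Icc (0 : ℝ) T} (h : s ≤ t) :
    differentialMeasure hx (Ioc s t) = x t - x s := by
  unfold differentialMeasure
  rw [hx.vectorMeasure_Ioc h, (hr s).rightLim_eq, (hr t).rightLim_eq]

theorem differentialMeasure_zero {x : Icc (0 : ℝ) T → H} (hx : BoundedVariationOn x univ)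
    (hr : ∀ t, ContinuousWithinAt x (Ici t) t) {t : Icc (0 : ℝ) T} (h : (t : ℝ) = 0) :
    differentialMeasure hx {t} = 0 := by
  unfold differentialMeasure
  rw [hx.vectorMeasure_singleton, (hr t).rightLim_eq, leftLim_eq_of_isBot, sub_self]
  intro b
  rw [← Subtype.coe_le_coe, h]
  exact b.2.1

/-- `m ≪ ν`: the vector measure `m` vanishes on the Borel sets that are `ν`-null. -/
def AbsCont (m : VectorMeasure (Icc (0 : ℝ) T) H) (ν : CompleteRadonMeasure T) : Prop :=
  ∀ B : Set (Icc (0 : ℝ) T), MeasurableSet B → ν.meas B = 0 → m B = 0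

/-- `v ∈ L¹_ν([0,T]; H)` is a Radon–Nikodým density of `m` with respect to `ν`. -/
def IsDensity (m : VectorMeasure (Icc (0 : ℝ) T) H) (ν : CompleteRadonMeasure T)
    (v : Icc (0 : ℝ) T → H) : Prop :=
  Integrable v ν.meas ∧
    ∀ B : Set (Icc (0 : ℝ) T), MeasurableSet B → m B = ∫ t in B, v t ∂ν.meas

open scoped Classical in
/-- The density `dm/dν`: a version of the Radon–Nikodým density (`0` if there is none). -/
def density (m : VectorMeasure (Icc (0 : ℝ) T) H) (ν : CompleteRadonMeasure T) :
    Icc (0 : ℝ) T → H :=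
  if h : ∃ v, IsDensity m ν v then h.choose else 0

end Differential

/-! ### Assumptions on the moving set -/

/-- Every `C t` is nonempty, closed, connected and `ρ`-uniformly prox-regular. -/
def AssumptionH1 (ρ : ℝ≥0∞) (C : Icc (0 : ℝ) T → Set H) : Prop :=
  ∀ t, (C t).Nonempty ∧ IsClosed (C t) ∧ IsConnected (C t) ∧ IsProxRegular ρ (C t)

/-- `C` is lower semicontinuous. -/
def AssumptionH2 (C : Icc (0 : ℝ) T → Set H) : Prop := LowerHemicontinuous C

/-- The bounded selection-extension property. -/
def AssumptionH3 (C : Icc (0 : ℝ) T → Set H) : Prop :=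
  ∀ x : Icc (0 : ℝ) T → H, (∃ M : ℝ, ∀ t, ‖x t‖ ≤ M) → (∀ t, x t ∈ C t) →
    ∀ η : ℝ, 0 < η → ∃ R : ℝ, 0 < R ∧
      ∀ (K : Set (Icc (0 : ℝ) T)) (y : Icc (0 : ℝ) T → H), IsCompact K → ContinuousOn y K →
        (∀ t ∈ K, y t ∈ C t) → (∀ t ∈ K, ‖y t - x t‖ ≤ η) →
        ∃ ybar : C(Icc (0 : ℝ) T, H),
          (∀ t, ybar t ∈ C t) ∧ (∀ t ∈ K, ybar t = y t) ∧ ∀ t, ‖ybar t‖ ≤ R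

/-! ### Admissible trajectories, residual, solutions -/

/-- `x` is an admissible trajectory for `C` starting at `x₀`. -/
structure IsAdmissible (C : Icc (0 : ℝ) T → Set H) (x₀ : H) (x : Icc (0 : ℝ) T → H) : Prop where
  bv : BoundedVariationOn x univ
  rightCont : ∀ t, ContinuousWithinAt x (Ici t) t
  init : ∀ t : Icc (0 : ℝ) T, (t : ℝ) = 0 → x t = x₀ ∧ x₀ ∈ C t
  mem : ∀ t, x t ∈ C t

/-- The class of admissible test trajectories: continuous maps `y` on `[0,T]` with `y t ∈ C t`
for `ν`-almost every `t`. -/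
def testClass (C : Icc (0 : ℝ) T → Set H) (ν : CompleteRadonMeasure T) :
    Set C(Icc (0 : ℝ) T, H) :=
  {y | ∀ᵐ t ∂ν.meas, y t ∈ C t}

/-- The integral `∫ (⟨v, y - x⟩ + ‖v‖ / (2ρ) * ‖y - x‖²) dν`. -/
def residualIntegral (ρ : ℝ≥0∞) (ν : CompleteRadonMeasure T) (v x y : Icc (0 : ℝ) T → H) : ℝ :=
  ∫ t, (inner ℝ (v t) (y t - x t) + halfInv ρ * ‖v t‖ * ‖y t - x t‖ ^ 2) ∂ν.meas

variable [CompleteSpace H]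

/-- The variational residual of `x` with respect to `ν`, an infimum in `[-∞, +∞]`. -/
def residual (ρ : ℝ≥0∞) (C : Icc (0 : ℝ) T → Set H) (ν : CompleteRadonMeasure T)
    {x : Icc (0 : ℝ) T → H} (hx : BoundedVariationOn x univ) : EReal :=
  ⨅ y ∈ testClass C ν,
    ((residualIntegral ρ ν (density (differentialMeasure hx) ν) x y : ℝ) : EReal)

/-- Solutions of the sweeping process in the sense of differential measures. -/
def IsDifferentialMeasureSolution (C : Icc (0 : ℝ) T → Set H) (x₀ : H)
    (x : Icc (0 : ℝ) T → H) : Prop :=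
  ∃ hx : IsAdmissible C x₀ x, ∃ (ν : CompleteRadonMeasure T) (v : Icc (0 : ℝ) T → H),
    AbsCont (differentialMeasure hx.bv) ν ∧ IsDensity (differentialMeasure hx.bv) ν v ∧
      ∀ᵐ t ∂ν.meas, -v t ∈ proxNormalCone (C t) (x t)

/-- Integral solutions of the sweeping process. -/
def IsIntegralSolution (ρ : ℝ≥0∞) (C : Icc (0 : ℝ) T → Set H) (x₀ : H)
    (x : Icc (0 : ℝ) T → H) : Prop :=
  ∃ hx : IsAdmissible C x₀ x, ∃ (ν : CompleteRadonMeasure T) (v : Icc (0 : ℝ) T → H),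
    AbsCont (differentialMeasure hx.bv) ν ∧ IsDensity (differentialMeasure hx.bv) ν v ∧
      ∀ y : C(Icc (0 : ℝ) T, H), (∀ᵐ t ∂ν.meas, y t ∈ C t) → 0 ≤ residualIntegral ρ ν v x y

end Sweeping

end SweepingProcess

end

/-! The residual integrates `proxGap`, the function ⟨v, z⟩ + ‖v‖/(2ρ) ‖z‖² at z = y(t) - x(t). By
prox-regularity, -v(t) is a proximal normal to C(t) at x(t) exactly when this gap is nonnegative at
every point of C(t). The theorem thus compares a pointwise inequality with its integral along
continuous maps.

From pointwise to integrated, one integrates. The converse is a localization: for a continuous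
selection y and a measurable B, consider the map equal to y on B and to x elsewhere. Inner
regularity and Lusin's theorem make it continuous on a compact set of almost full measure. (H3)
extends it from there with a bound that does not depend on the compact set, so the error is
controlled by the integral of ‖v‖ over a small set (`exists_selection_integral_proxGap_close`).
Hence the gap along y has nonnegative integral over every B, and is nonnegative a.e. The exceptional
null set depends on y; `ae_forall_proxGap_nonneg` removes this dependence without assuming H
separable. The case B = ∅ shows that the residual is at most 0.

The reference measure is irrelevant: dx has a density g with respect to its variation |dx|, every
other density is a nonnegative multiple of g, and normal cones are stable under such multiples
(`ae_neg_density_mem_of_cone`). -/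

noncomputable section

namespace SweepingProcess

/-! ### Inner regular measures: Borel approximation and Lusin's theorem -/

section Regularity

variable {X : Type*} [TopologicalSpace X] [T2Space X] [MeasurableSpace X] [OpensMeasurableSpace X]
  {μ : Measure X} [IsFiniteMeasure μ] [μ.InnerRegular]

/-- Every measurable set contains a Borel set of the same measure. -/
theorem exists_borel_subset_measure_diff_eq_zero {E : Set X} (hE : MeasurableSet E) :
    ∃ B ⊆ E, MeasurableSet[borel X] B ∧ μ (E \ B) = 0 := by
  -- The Borel set is a countable union of compact sets exhausting `E` in measure.
  have h (n : ℕ) : ∃ K ⊆ E, IsCompact K ∧ μ (E \ K) < ((n : ℝ≥0∞) + 1)⁻¹ :=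
    hE.exists_isCompact_sdiff_lt (measure_ne_top μ E) (by simp)
  choose K hKE hK hlt using h
  refine ⟨⋃ n, K n, iUnion_subset hKE, ?_, ?_⟩
  · exact @MeasurableSet.iUnion _ _ (borel X) _ _ fun n =>
      @MeasurableSet.of_compl _ _ (borel X)
        (MeasurableSpace.measurableSet_generateFrom (hK n).isClosed.isOpen_compl)
  · refine le_antisymm (ENNReal.le_of_forall_pos_le_add fun ε hε _ => ?_) zero_le
    obtain ⟨n, hn⟩ := ENNReal.exists_inv_nat_lt (ENNReal.coe_pos.2 hε).ne'
    rw [zero_add]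
    calc μ (E \ ⋃ n, K n) ≤ μ (E \ K n) :=
          measure_mono (sdiff_subset_sdiff_right (subset_iUnion _ _))
      _ ≤ ((n : ℝ≥0∞) + 1)⁻¹ := (hlt n).le
      _ ≤ (n : ℝ≥0∞)⁻¹ := ENNReal.inv_le_inv.2 le_self_add
      _ ≤ ε := hn.le

/-- **Lusin's theorem**. -/
theorem exists_isCompact_continuousOn {Y : Type*} [TopologicalSpace Y]
    [TopologicalSpace.PseudoMetrizableSpace Y] {f : X → Y} (hf : StronglyMeasurable f) {B : Set X}
    (hB : MeasurableSet B) {ε : ℝ≥0∞} (hε : ε ≠ 0) :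
    ∃ K ⊆ B, IsCompact K ∧ μ (B \ K) < ε ∧ ContinuousOn f K := by
  borelize Y
  have : SecondCountableTopology (range f) := hf.isSeparable_range.secondCountableTopology
  let N := TopologicalSpace.countableBasis (range f)
  have hbasis := TopologicalSpace.isBasis_countableBasis (range f)
  have : Countable N := (TopologicalSpace.countable_countableBasis (range f)).to_subtype
  let g : X → range f := rangeFactorization f
  have hg : Measurable g := hf.measurable.subtype_mk
  -- For each basic open set, its preimage and the complement in `B` are approximated by disjoint
  -- compact sets; on their union the preimage is relatively open. The index `none` provides one
  -- compact set even if the basis is empty.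
  obtain ⟨δ, hδ0, hδ⟩ := ENNReal.exists_pos_sum_of_countable' hε (Option N)
  have key (i : Option N) : ∃ K ⊆ B, IsCompact K ∧ μ (B \ K) < δ i ∧
      ∀ U ∈ i, ∃ L, IsClosed L ∧ ∀ t ∈ K, g t ∈ (U : Set (range f)) ↔ t ∉ L := by
    rcases i with _ | U
    · obtain ⟨K, h1, h2, h3⟩ := hB.exists_isCompact_sdiff_lt (measure_ne_top μ B) (hδ0 none).ne'
      exact ⟨K, h1, h2, h3, by simp⟩
    · have hU : MeasurableSet (g ⁻¹' (U : Set (range f))) :=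
        hg (TopologicalSpace.isOpen_of_mem_countableBasis U.2).measurableSet
      have hδ2 := (ENNReal.half_pos (hδ0 (some U)).ne').ne'
      obtain ⟨K, h1, h2, h3⟩ :=
        (hB.inter hU).exists_isCompact_sdiff_lt (measure_ne_top μ _) hδ2
      obtain ⟨L, h4, h5, h6⟩ :=
        (hB.diff hU).exists_isCompact_sdiff_lt (measure_ne_top μ _) hδ2
      refine ⟨K ∪ L, union_subset (h1.trans inter_subset_left) (h4.trans sdiff_subset),
        h2.union h5, ?_, ?_⟩
      · calc μ (B \ (K ∪ L)) ≤ μ ((B ∩ g ⁻¹' U) \ K ∪ (B \ g ⁻¹' U) \ L) := by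
              refine measure_mono fun t ht => ?_
              simp only [mem_union, mem_sdiff, mem_inter_iff] at ht ⊢
              tauto
          _ ≤ _ := measure_union_le _ _
          _ < δ (some U) / 2 + δ (some U) / 2 := ENNReal.add_lt_add h3 h6
          _ = δ (some U) := ENNReal.add_halves _
      · rintro V hV
        obtain rfl : U = V := by simpa using hV
        refine ⟨L, h5.isClosed, ?_⟩
        rintro t (ht | ht)
        · exact iff_of_true (h1 ht).2 fun h => (h4 h).2 (h1 ht).2
        · exact iff_of_false (h4 ht).2 fun h => h ht
  choose K hKB hK hlt hL using key
  refine ⟨⋂ i, K i, (iInter_subset _ none).trans (hKB none),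
    (hK none).of_isClosed_subset (isClosed_iInter fun i => (hK i).isClosed) (iInter_subset _ none),
    ?_, ?_⟩
  · calc μ (B \ ⋂ i, K i) = μ (⋃ i, B \ K i) := by rw [sdiff_iInter]
      _ ≤ ∑' i, μ (B \ K i) := measure_iUnion_le _
      _ ≤ ∑' i, δ i := ENNReal.tsum_le_tsum fun i => (hlt i).le
      _ < ε := hδ
  · have hcont : Continuous ((⋂ i, K i).domRestrict g) := by
      refine hbasis.continuous_iff.2 fun U hU => ?_
      obtain ⟨L, hLc, hLU⟩ := hL (some ⟨U, hU⟩) _ rfl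
      have : (⋂ i, K i).domRestrict g ⁻¹' U = Subtype.val ⁻¹' Lᶜ := by
        ext t
        exact hLU t (mem_iInter.1 t.2 _)
      rw [this]
      exact hLc.isOpen_compl.preimage continuous_subtype_val
    exact continuousOn_iff_continuous_domRestrict.2 (continuous_subtype_val.comp hcont)

/-- A property that holds almost everywhere holds outside a Borel null set. -/
theorem ae_trim_of_ae {X : Type*} {m₀ mX : MeasurableSpace X} [TopologicalSpace X] [T2Space X]
    [OpensMeasurableSpace X] {μ : Measure X} [IsFiniteMeasure μ] [μ.InnerRegular]
    (h₀ : m₀ = borel X) (hm : m₀ ≤ mX) {P : X → Prop} (h : ∀ᵐ t ∂μ, P t) :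
    ∀ᵐ t ∂μ.trim hm, P t := by
  subst h₀
  obtain ⟨N, hPN, hN, hN0⟩ := exists_measurable_superset_of_null (ae_iff.1 h)
  obtain ⟨B, hB, hBm, hB0⟩ := exists_borel_subset_measure_diff_eq_zero (μ := μ) hN.compl
  refine measure_mono_null (t := Bᶜ) (fun t ht htB => hB htB (hPN ht)) ?_
  rw [trim_measurableSet_eq hm (@MeasurableSet.compl _ _ (borel X) hBm)]
  refine measure_mono_null (t := N ∪ Nᶜ \ B) (fun t ht => ?_) (measure_union_null hN0 hB0)
  by_cases h : t ∈ N
  · exact Or.inl h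
  · exact Or.inr ⟨h, ht⟩

/-- Integrable functions with the same integral over each Borel set agree almost everywhere. -/
theorem ae_eq_of_forall_borel_setIntegral_eq {E : Type*} [NormedAddCommGroup E] [NormedSpace ℝ E]
    [CompleteSpace E] {f g : X → E} (hf : Integrable f μ) (hg : Integrable g μ)
    (h : ∀ B, MeasurableSet[borel X] B → ∫ t in B, f t ∂μ = ∫ t in B, g t ∂μ) : f =ᵐ[μ] g := by
  refine hf.ae_eq_of_forall_setIntegral_eq _ _ hg fun s hs _ => ?_
  obtain ⟨B, hB, hBm, hB0⟩ := exists_borel_subset_measure_diff_eq_zero (μ := μ) hs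
  have hBs : s =ᵐ[μ] B := (ae_le_set.2 hB0).antisymm hB.eventuallyLE
  rw [setIntegral_congr_set hBs, setIntegral_congr_set hBs, h B hBm]

end Regularity

/-! ### Polar decomposition of a Hilbert-valued measure -/

section RadonNikodym

variable {X : Type*} [MeasurableSpace X]
  {H : Type*} [NormedAddCommGroup H] [InnerProductSpace ℝ H] [CompleteSpace H]

/-- A Hilbert-valued vector measure of finite variation has a density with respect to its
variation. -/
theorem exists_density_variation (m : VectorMeasure X H) [IsFiniteMeasure m.variation] :
    ∃ g : X → H, StronglyMeasurable g ∧ Integrable g m.variation ∧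
      ∀ B, MeasurableSet B → m B = ∫ t in B, g t ∂m.variation := by
  let B := innerSL ℝ (E := H)
  let c : ℝ := ((m.variation univ) ^ (1 / (2 : ℝ))).toReal
  have hint (f : Lp H 2 m.variation) : Integrable f m.variation :=
    (Lp.memLp f).integrable one_le_two
  -- Integration against `m` is a bounded functional on L² of the finite measure |m|; its Riesz
  -- representative is the density.
  let L₀ : Lp H 2 m.variation →ₗ[ℝ] ℝ :=
    { toFun f := m.integral f B
      map_add' f g := by
        rw [← VectorMeasure.integral_add (hint f) (hint g)]
        exact VectorMeasure.integral_congr_ae (Lp.coeFn_add f g)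
      map_smul' r f := by
        rw [RingHom.id_apply, ← VectorMeasure.integral_smul]
        exact VectorMeasure.integral_congr_ae (Lp.coeFn_smul r f) }
  have hbound (f : Lp H 2 m.variation) : ‖L₀ f‖ ≤ ‖B‖ * c * ‖f‖ := by
    refine (VectorMeasure.norm_integral_le_integral_norm).trans ?_
    rw [mul_assoc]
    gcongr
    rw [integral_norm_eq_lintegral_enorm (Lp.aestronglyMeasurable f), ← eLpNorm_one_eq_lintegral_enorm,
      Lp.norm_def, ← ENNReal.toReal_mul, mul_comm]
    refine ENNReal.toReal_mono ?_ ?_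
    · exact ENNReal.mul_ne_top (Lp.eLpNorm_ne_top f)
        (ENNReal.rpow_ne_top_of_nonneg (by norm_num) (measure_ne_top _ _))
    · convert eLpNorm_le_eLpNorm_mul_rpow_measure_univ (p := 1) (q := 2) one_le_two
        (Lp.aestronglyMeasurable f) using 3
      norm_num
  let L : StrongDual ℝ (Lp H 2 m.variation) := L₀.mkContinuous _ hbound
  let G := (InnerProductSpace.toDual ℝ _).symm L
  have hG (A : Set X) (hA : MeasurableSet A) : m A = ∫ t in A, G t ∂m.variation := by
    refine ext_inner_left ℝ fun z => ?_
    rw [← L2.inner_indicatorConstLp_eq_inner_setIntegral ℝ hA (measure_ne_top _ _) z G,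
      real_inner_comm G, InnerProductSpace.toDual_symm_apply]
    change _ = m.integral (indicatorConstLp 2 hA (measure_ne_top _ _) z) B
    rw [VectorMeasure.integral_congr_ae indicatorConstLp_coeFn,
      VectorMeasure.integral_indicator_const z hA]
    rfl
  refine ⟨G, Lp.stronglyMeasurable G, hint G, hG⟩

end RadonNikodym

/-! ### Finite variation of the differential measure -/

section Variation

variable {H : Type*} [NormedAddCommGroup H] [InnerProductSpace ℝ H] [CompleteSpace H] {T : ℝ}

/-- The differential measure of a right-continuous map of bounded variation has finite
variation. -/
theorem isFiniteMeasure_variation_differentialMeasure (hT : 0 ≤ T) {x : Icc (0 : ℝ) T → H}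
    (hx : BoundedVariationOn x univ) (hr : ∀ t, ContinuousWithinAt x (Ici t) t) :
    IsFiniteMeasure (differentialMeasure hx).variation := by
  let o : Icc (0 : ℝ) T := ⟨0, le_rfl, hT⟩
  let e : Icc (0 : ℝ) T := ⟨T, hT, le_rfl⟩
  have : Nonempty (Icc (0 : ℝ) T) := ⟨o⟩
  have ho (t : Icc (0 : ℝ) T) : o ≤ t := t.2.1
  -- The Stieltjes measure of the variation function dominates the increments on half-open
  -- intervals, hence also their extension to Borel sets.
  let m := (hx.stieltjesFunctionRightLim o).measure
  have hm : IsFiniteMeasure m :=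
    StieltjesFunction.isFiniteMeasure_of_forall_abs_le
      (C := (eVariationOn x.rightLim univ).toReal) _ fun t =>
        variationOnFromTo.abs_le_eVariationOn hx.rightLim
  let 𝒞 : Set (Set (Icc (0 : ℝ) T)) := {s | ∃ u v, u ≤ v ∧ s = Ioc u v}
  have hle : ∀ s ∈ 𝒞, ‖AddContent.onIoc x.rightLim s‖ₑ ≤ m s := by
    rintro s ⟨u, v, huv, rfl⟩
    rw [AddContent.onIoc_apply huv, StieltjesFunction.measure_Ioc]
    simp only [BoundedVariationOn.stieltjesFunctionRightLim_apply]
    rw [← variationOnFromTo.add hx.rightLim.locallyBoundedVariationOn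
      (mem_univ o) (mem_univ u) (mem_univ v)]
    simp only [add_sub_cancel_left, variationOnFromTo, huv, ↓reduceIte, univ_inter]
    rw [ENNReal.ofReal_toReal
      ((eVariationOn.mono _ (subset_univ _)).trans_lt hx.rightLim.lt_top).ne, ← edist_eq_enorm_sub]
    exact eVariationOn.edist_le _ (by grind) (by grind)
  have hgen : (inferInstance : MeasurableSpace (Icc (0 : ℝ) T)) =
      MeasurableSpace.generateFrom 𝒞 := by
    rw [BorelSpace.measurable_eq (α := Icc (0 : ℝ) T)]
    convert! borel_eq_generateFrom_Ioc_le (Icc (0 : ℝ) T) using 2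
    grind only
  obtain ⟨m', hm', hm'le⟩ :=
    VectorMeasure.exists_extension_of_isSetSemiring_of_le_measure_of_generateFrom
      IsSetSemiring.Ioc hle hgen
  have hIoc : ∀ s ∈ 𝒞, m' s = differentialMeasure hx s := by
    rintro s ⟨u, v, huv, rfl⟩
    rw [hm' _ ⟨u, v, huv, rfl⟩, AddContent.onIoc_apply huv, differentialMeasure,
      hx.vectorMeasure_Ioc huv]
  have hzero : m' {o} = 0 := by
    rw [← enorm_eq_zero, ← nonpos_iff_eq_zero]
    refine (hm'le _).trans ?_
    rw [← botSet_eq_singleton_of_isBot ho]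
    simp [m]
  -- No interval ]u, v] contains 0, so equality of total masses needs the atom at 0 separately.
  have huniv : (univ : Set (Icc (0 : ℝ) T)) = {o} ∪ Ioc o e := by
    ext t
    rcases (ho t).eq_or_lt with h | h
    · simp [h]
    · exact iff_of_true trivial (Or.inr ⟨h, t.2.2⟩)
  have heq : m' = differentialMeasure hx := by
    refine VectorMeasure.ext_of_generateFrom 𝒞 hIoc hgen IsSetSemiring.Ioc.isPiSystem ?_
    have hd : Disjoint {o} (Ioc o e) := by simp
    rw [huniv, VectorMeasure.of_union hd (measurableSet_singleton o) measurableSet_Ioc,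
      VectorMeasure.of_union hd (measurableSet_singleton o) measurableSet_Ioc,
      hIoc _ ⟨o, e, ho e, rfl⟩, hzero, differentialMeasure_zero hx hr rfl]
  rw [← heq]
  exact ⟨(VectorMeasure.variation_le_of_forall_enorm_le (fun E _ => hm'le E) univ).trans_lt
    (measure_lt_top m univ)⟩

end Variation

/-- A right-continuous map on `[0,T]` is strongly measurable. -/
theorem stronglyMeasurable_of_rightCont {T : ℝ} (hT : 0 ≤ T) {E : Type*} [TopologicalSpace E]
    [TopologicalSpace.PseudoMetrizableSpace E] {x : Icc (0 : ℝ) T → E}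
    (hr : ∀ t, ContinuousWithinAt x (Ici t) t) : StronglyMeasurable x := by
  -- `x` is sampled at the next grid point to the right of `t`, projected to [0,T], which keeps it
  -- at or after `t`.
  let a (n : ℕ) (k : ℤ) : Icc (0 : ℝ) T := projIcc 0 T hT ((k + 1) / ((n : ℝ) + 1))
  let k (n : ℕ) (t : Icc (0 : ℝ) T) : ℤ := ⌊(t : ℝ) * ((n : ℝ) + 1)⌋
  have hk (n : ℕ) : Measurable (k n) := by fun_prop
  refine stronglyMeasurable_of_tendsto (f := fun n : ℕ => fun t => x (a n (k n t))) Filter.atTop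
    (fun n => (StronglyMeasurable.of_discrete (f := fun j => x (a n j))).comp_measurable (hk n)) ?_
  refine tendsto_pi_nhds.2 fun t => (hr t).tendsto.comp ?_
  have hn (n : ℕ) : (0 : ℝ) < n + 1 := by positivity
  have hge (n : ℕ) : (t : ℝ) ≤ (k n t + 1) / ((n : ℝ) + 1) := by
    rw [le_div_iff₀ (hn n)]
    exact (Int.lt_floor_add_one _).le
  have hle (n : ℕ) : (k n t + 1) / ((n : ℝ) + 1) ≤ t + 1 / ((n : ℝ) + 1) := by
    rw [add_div]
    gcongr
    rw [div_le_iff₀ (hn n)]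
    exact Int.floor_le _
  refine tendsto_nhdsWithin_iff.2 ⟨?_, Filter.Eventually.of_forall fun n => ?_⟩
  · have h1 : Filter.Tendsto (fun n : ℕ => ((k n t : ℝ) + 1) / ((n : ℝ) + 1)) Filter.atTop
        (𝓝 (t : ℝ)) := by
      refine tendsto_of_tendsto_of_tendsto_of_le_of_le tendsto_const_nhds ?_ hge hle
      simpa using tendsto_const_nhds.add (tendsto_one_div_add_atTop_nhds_zero_nat (𝕜 := ℝ))
    have h2 := (continuous_projIcc (h := hT)).continuousAt.tendsto.comp h1
    rwa [projIcc_val] at h2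
  · exact (projIcc_val hT t).ge.trans (monotone_projIcc hT (hge n))

/-! ### The gap function and proximal normals -/

section Integrand

variable {H : Type*} [NormedAddCommGroup H] [InnerProductSpace ℝ H]

/-- The function `⟨v, z⟩ + h ‖v‖ ‖z‖²`, whose sign on `C - x` characterises proximal normals. -/
def proxGap (h : ℝ) (v z : H) : ℝ := inner ℝ v z + h * ‖v‖ * ‖z‖ ^ 2

theorem halfInv_nonneg (ρ : ℝ≥0∞) : 0 ≤ halfInv ρ := ENNReal.toReal_nonneg

@[simp]
theorem proxGap_zero (h : ℝ) (v : H) : proxGap h v 0 = 0 := by simp [proxGap]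

theorem abs_proxGap_le {h D : ℝ} (hh : 0 ≤ h) {v z : H} (hz : ‖z‖ ≤ D) :
    |proxGap h v z| ≤ (D + h * D ^ 2) * ‖v‖ := by
  have h1 : |inner ℝ v z| ≤ ‖v‖ * D := (abs_real_inner_le_norm v z).trans (by gcongr)
  have h2 : |h * ‖v‖ * ‖z‖ ^ 2| ≤ h * ‖v‖ * D ^ 2 := by
    rw [abs_of_nonneg (by positivity)]
    gcongr
  calc |proxGap h v z| ≤ ‖v‖ * D + h * ‖v‖ * D ^ 2 := (abs_add_le _ _).trans (add_le_add h1 h2)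
    _ = _ := by ring

theorem integrable_proxGap {X : Type*} {mX : MeasurableSpace X} {μ : Measure X} {h D : ℝ} (hh : 0 ≤ h) {v z : X → H} (hv : Integrable v μ)
    (hz : AEStronglyMeasurable z μ) (hD : ∀ t, ‖z t‖ ≤ D) :
    Integrable (fun t => proxGap h (v t) (z t)) μ := by
  refine (hv.norm.const_mul (D + h * D ^ 2)).mono' ?_
    (Filter.Eventually.of_forall fun t => abs_proxGap_le hh (hD t))
  have hv' := hv.aestronglyMeasurable
  exact (hv'.inner hz).add ((hv'.norm.const_mul h).mul (hz.norm.pow 2))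

/-- Membership in the proximal normal cone in terms of the points of the set only. -/
theorem mem_proxNormalCone_iff {S : Set H} {x ζ : H} :
    ζ ∈ proxNormalCone S x ↔ x ∈ S ∧ ∃ σ : ℝ, 0 ≤ σ ∧ ∃ η : ℝ, 0 < η ∧
      ∀ y ∈ S, ‖y - x‖ < η → inner ℝ ζ (y - x) ≤ σ * ‖y - x‖ ^ 2 := by
  simp only [proxNormalCone, proxSubdiff, indicatorFn, mem_ofPred_eq]
  by_cases hx : x ∈ S
  · simp only [hx, if_true, EReal.zero_ne_top, ne_eq, not_false_eq_true, true_and, zero_add,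
      mem_ball_iff_norm]
    refine exists_congr fun σ => and_congr_right fun _ => exists_congr fun η =>
      and_congr_right fun _ => forall_congr' fun y => ?_
    by_cases hy : y ∈ S
    · simp only [hy, if_true, forall_const]
      rw [← EReal.coe_zero, EReal.coe_le_coe_iff, sub_nonpos]
    · simp [hy]
  · simp [hx]

theorem zero_mem_proxNormalCone {S : Set H} {x : H} (hx : x ∈ S) : 0 ∈ proxNormalCone S x :=
  mem_proxNormalCone_iff.2 ⟨hx, 0, le_rfl, 1, one_pos, by simp⟩

theorem smul_mem_proxNormalCone {S : Set H} {x ζ : H} {a : ℝ} (ha : 0 ≤ a)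
    (h : ζ ∈ proxNormalCone S x) : a • ζ ∈ proxNormalCone S x := by
  obtain ⟨hx, σ, hσ, η, hη, H⟩ := mem_proxNormalCone_iff.1 h
  refine mem_proxNormalCone_iff.2 ⟨hx, a * σ, mul_nonneg ha hσ, η, hη, fun y hy hyx => ?_⟩
  rw [real_inner_smul_left, mul_assoc]
  exact mul_le_mul_of_nonneg_left (H y hy hyx) ha

/-- The gap inequality is the proximal inequality with σ = h‖v‖; it is global, so the radius 1 is
arbitrary. -/
theorem neg_mem_proxNormalCone_of_proxGap_nonneg {S : Set H} {h : ℝ} (hh : 0 ≤ h) {x v : H}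
    (hx : x ∈ S) (H : ∀ z ∈ S, 0 ≤ proxGap h v (z - x)) : -v ∈ proxNormalCone S x := by
  refine mem_proxNormalCone_iff.2 ⟨hx, h * ‖v‖, by positivity, 1, one_pos, fun y hy _ => ?_⟩
  have := H y hy
  rw [proxGap] at this
  rw [inner_neg_left]
  linarith

theorem IsProxRegular.proxGap_nonneg {ρ : ℝ≥0∞} {S : Set H} (hS : IsProxRegular ρ S) {x v z : H}
    (hx : x ∈ S) (hz : z ∈ S) (hv : -v ∈ proxNormalCone S x) :
    0 ≤ proxGap (halfInv ρ) v (z - x) := by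
  have := hS.2.2 x hx (-v) hv z hz
  rw [inner_neg_left, norm_neg] at this
  rw [proxGap]
  linarith

end Integrand

/-! ### Localization by selections, and a common null set -/

section Localization

variable {X : Type*} [TopologicalSpace X] [CompactSpace X] [T2Space X] [MeasurableSpace X]
  [OpensMeasurableSpace X] {μ : Measure X} [IsFiniteMeasure μ]
  {H : Type*} [NormedAddCommGroup H] [InnerProductSpace ℝ H]

theorem stronglyMeasurable_continuousMap (y : C(X, H)) : StronglyMeasurable y := by
  borelize H
  exact stronglyMeasurable_iff_measurable_separable.2
    ⟨y.continuous.measurable, (isCompact_range y.continuous).isSeparable⟩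

/-- If continuous maps near `x` on a compact set with values in `C` extend to uniformly bounded
continuous selections of `C`, then the map equal to a continuous selection `y` on a measurable set
`B` and to `x` elsewhere is approximated, in the sense of the residual integral, by continuous
selections. -/
theorem exists_selection_integral_proxGap_close [μ.InnerRegular] {C : X → Set H} {x : X → H}
    (hx : StronglyMeasurable x) {M : ℝ} (hM : ∀ t, ‖x t‖ ≤ M) (hxC : ∀ t, x t ∈ C t)
    (hext : ∀ η : ℝ, 0 < η → ∃ R : ℝ, 0 < R ∧
      ∀ (K : Set X) (y : X → H), IsCompact K → ContinuousOn y K →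
        (∀ t ∈ K, y t ∈ C t) → (∀ t ∈ K, ‖y t - x t‖ ≤ η) →
        ∃ ybar : C(X, H), (∀ t, ybar t ∈ C t) ∧ (∀ t ∈ K, ybar t = y t) ∧ ∀ t, ‖ybar t‖ ≤ R)
    {h : ℝ} (hh : 0 ≤ h) {v : X → H} (hv : Integrable v μ) (y : C(X, H)) (hy : ∀ t, y t ∈ C t)
    {B : Set X} (hB : MeasurableSet B) {ε : ℝ} (hε : 0 < ε) :
    ∃ ybar : C(X, H), (∀ t, ybar t ∈ C t) ∧
      |∫ t, proxGap h (v t) (ybar t - x t) ∂μ - ∫ t in B, proxGap h (v t) (y t - x t) ∂μ| ≤ ε := by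
  classical
  obtain ⟨N, hN⟩ : ∃ N, ∀ t, ‖y t‖ ≤ N := ⟨‖y‖, y.norm_coe_le_norm⟩
  have hyx (t : X) : ‖y t - x t‖ ≤ |N| + |M| :=
    (norm_sub_le _ _).trans (add_le_add ((hN t).trans (le_abs_self _)) ((hM t).trans (le_abs_self _)))
  -- The bound `R` is fixed before the compact sets, so the dominating constant `c` does not depend
  -- on them.
  obtain ⟨R, hR, hRext⟩ := hext (|N| + |M| + 1) (by positivity)
  set D : ℝ := R + |N| + |M|
  set c : ℝ := D + h * D ^ 2
  have hc : 0 ≤ c := by positivity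
  have hg : Integrable (fun t => (2 * c) * ‖v t‖) μ := hv.norm.const_mul _
  obtain ⟨δ, hδ0, hδ⟩ := exists_pos_setLIntegral_lt_of_measure_lt
    (f := fun t => ‖(2 * c) * ‖v t‖‖ₑ) hg.2.ne (ENNReal.ofReal_pos.2 hε).ne'
  have hδ2 : δ / 2 ≠ 0 := (ENNReal.half_pos hδ0.ne').ne'
  obtain ⟨K, hKB, hK, hKδ⟩ := hB.exists_isCompact_sdiff_lt (measure_ne_top μ B) hδ2
  obtain ⟨L, hLB, hL, hLδ, hxL⟩ := exists_isCompact_continuousOn (μ := μ) hx hB.compl hδ2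
  have hdisj : ∀ t ∈ L, t ∉ K := fun t htL htK => hLB htL (hKB htK)
  have hmeas : μ (K ∪ L)ᶜ < δ := by
    calc μ (K ∪ L)ᶜ ≤ μ (B \ K ∪ Bᶜ \ L) := by
          refine measure_mono fun t ht => ?_
          simp only [mem_union, mem_sdiff, mem_compl_iff] at ht ⊢
          tauto
      _ ≤ _ := measure_union_le _ _
      _ < δ / 2 + δ / 2 := ENNReal.add_lt_add hKδ hLδ
      _ = δ := ENNReal.add_halves _
  let w : X → H := K.piecewise y x
  have hwK : EqOn w y K := piecewise_eqOn _ _ _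
  have hwL : EqOn w x L := fun t ht => piecewise_eq_of_notMem _ _ _ (hdisj t ht)
  obtain ⟨ybar, hbC, hbw, hbR⟩ := hRext (K ∪ L) w (hK.union hL)
    ((y.continuous.continuousOn.congr hwK).union_of_isClosed (hxL.congr hwL) hK.isClosed
      hL.isClosed)
    (by
      rintro t (ht | ht)
      · rw [hwK ht]; exact hy t
      · rw [hwL ht]; exact hxC t)
    (by
      rintro t (ht | ht)
      · rw [hwK ht]; linarith [hyx t]
      · rw [hwL ht, sub_self, norm_zero]; positivity)
  refine ⟨ybar, hbC, ?_⟩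
  have hbx (t : X) : ‖ybar t - x t‖ ≤ D := by
    refine (norm_sub_le _ _).trans ?_
    linarith [hbR t, (hM t).trans (le_abs_self M), abs_nonneg N]
  have hyx' (t : X) : ‖y t - x t‖ ≤ D := (hyx t).trans (by linarith)
  have hfb : Integrable (fun t => proxGap h (v t) (ybar t - x t)) μ := integrable_proxGap hh hv
    ((stronglyMeasurable_continuousMap ybar).sub hx).aestronglyMeasurable hbx
  have hfy : Integrable (fun t => proxGap h (v t) (y t - x t)) μ := integrable_proxGap hh hv
    ((stronglyMeasurable_continuousMap y).sub hx).aestronglyMeasurable hyx'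
  have hKL : MeasurableSet (K ∪ L)ᶜ := (hK.union hL).measurableSet.compl
  rw [← integral_indicator hB, ← integral_sub hfb (hfy.indicator hB)]
  set F : X → ℝ := fun t => proxGap h (v t) (ybar t - x t) -
    B.indicator (fun t => proxGap h (v t) (y t - x t)) t
  have hF0 : ∀ t ∉ (K ∪ L)ᶜ, F t = 0 := by
    intro t ht
    rcases not_not.1 ht with ht' | ht'
    · simp [F, hbw t (Or.inl ht'), hwK ht', hKB ht']
    · have : t ∉ B := hLB ht'
      simp [F, hbw t (Or.inr ht'), hwL ht', this]
  have hFle (t : X) : ‖F t‖ ≤ (2 * c) * ‖v t‖ := by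
    have h1 := abs_proxGap_le hh (v := v t) (hbx t)
    have h2 : |B.indicator (fun t => proxGap h (v t) (y t - x t)) t| ≤ c * ‖v t‖ := by
      by_cases ht : t ∈ B
      · simpa [ht] using abs_proxGap_le hh (v := v t) (hyx' t)
      · simpa [ht] using mul_nonneg hc (norm_nonneg _)
    calc ‖F t‖ ≤ c * ‖v t‖ + c * ‖v t‖ := (norm_sub_le _ _).trans (add_le_add h1 h2)
      _ = _ := by ring
  rw [← setIntegral_eq_integral_of_forall_compl_eq_zero hF0, ← Real.norm_eq_abs]
  calc ‖∫ t in (K ∪ L)ᶜ, F t ∂μ‖ ≤ ∫ t in (K ∪ L)ᶜ, (2 * c) * ‖v t‖ ∂μ :=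
        norm_integral_le_of_norm_le hg.integrableOn (Filter.Eventually.of_forall hFle)
    _ ≤ (∫⁻ t in (K ∪ L)ᶜ, ‖(2 * c) * ‖v t‖‖ₑ ∂μ).toReal := by
        rw [← integral_norm_eq_lintegral_enorm hg.aestronglyMeasurable.restrict]
        exact integral_mono hg.integrableOn hg.norm.integrableOn fun t => le_abs_self _
    _ ≤ ε := ENNReal.toReal_le_of_le_ofReal hε.le (hδ _ hmeas).le

/-- If all maps of a class of continuous maps, passing through all points of the sets `C t`, satisfy
a proximal normal inequality almost everywhere, then for almost every `t` the inequality holds at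
all points of `C t`. -/
theorem ae_forall_proxGap_nonneg [CompleteSpace H] [SecondCountableTopology X] {C : X → Set H}
    {x : X → H} (hx : StronglyMeasurable x) {S : Set C(X, H)}
    (hS : ∀ t, ∀ z ∈ C t, ∃ y ∈ S, y t = z) {h : ℝ} {v : X → H} (hv : AEStronglyMeasurable v μ)
    (hSv : ∀ y ∈ S, ∀ᵐ t ∂μ, 0 ≤ proxGap h (v t) (y t - x t)) :
    ∀ᵐ t ∂μ, ∀ z ∈ C t, 0 ≤ proxGap h (v t) (z - x t) := by
  -- The gap depends on `y t` only through its norm and its projection on a separable subspace.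
  obtain ⟨u, hu, hvu⟩ := hv
  let W : Submodule ℝ H := (Submodule.span ℝ (range u ∪ range x)).topologicalClosure
  have hW : TopologicalSpace.IsSeparable (W : Set H) := by
    rw [Submodule.topologicalClosure_coe, TopologicalSpace.isSeparable_closure]
    exact (hu.isSeparable_range.union hx.isSeparable_range).span
  have : SecondCountableTopology W := hW.secondCountableTopology
  have huW (t : X) : u t ∈ W :=
    Submodule.le_topologicalClosure _ (Submodule.subset_span (Or.inl ⟨t, rfl⟩))
  have hxW (t : X) : x t ∈ W :=
    Submodule.le_topologicalClosure _ (Submodule.subset_span (Or.inr ⟨t, rfl⟩))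
  let Φ (y : C(X, H)) : C(X, W × ℝ) :=
    ⟨fun t => (W.orthogonalProjectionOnto (y t), ‖y t‖), by fun_prop⟩
  let Q (t : X) (p : W × ℝ) : ℝ := inner ℝ (⟨u t, huW t⟩ : W) p.1 - inner ℝ (u t) (x t) +
    h * ‖u t‖ * (p.2 ^ 2 - 2 * inner ℝ (⟨x t, hxW t⟩ : W) p.1 + ‖x t‖ ^ 2)
  have hQ (t : X) : Continuous (Q t) := by fun_prop
  have hQΦ (y : C(X, H)) (t : X) : Q t (Φ y t) = proxGap h (u t) (y t - x t) := by
    simp only [Q, Φ, ContinuousMap.coe_mk, proxGap, inner_sub_right, norm_sub_sq_real,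
      Submodule.inner_orthogonalProjectionOnto_eq_of_mem_left, real_inner_comm (x t) (y t)]
  -- Maps from a compact second countable space to the separable metric space `W × ℝ` form a
  -- separable space. A countable dense family thus needs only one null set, and continuity of `Q t`
  -- carries the inequality to its closure.
  obtain ⟨D, hDS, hDc, hD⟩ :=
    (TopologicalSpace.IsSeparable.of_separableSpace (Φ '' S)).exists_countable_dense_subset
  have hae : ∀ᵐ t ∂μ, ∀ φ ∈ D, 0 ≤ Q t (φ t) := by
    refine (ae_ball_iff hDc).2 fun φ hφ => ?_
    obtain ⟨y, hy, rfl⟩ := hDS hφ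
    filter_upwards [hSv y hy, hvu] with t ht htu
    rwa [hQΦ, ← htu]
  filter_upwards [hae, hvu] with t ht htu z hz
  obtain ⟨y, hy, rfl⟩ := hS t z hz
  have hclosed : IsClosed {φ : C(X, W × ℝ) | 0 ≤ Q t (φ t)} :=
    isClosed_le continuous_const ((hQ t).comp (continuous_eval_const t))
  have hy0 : 0 ≤ Q t (Φ y t) := closure_minimal ht hclosed (hD (mem_image_of_mem Φ hy))
  rwa [hQΦ, ← htu] at hy0

end Localization

/-! ### Densities and change of reference measure -/

section Densities

variable {H : Type*} [NormedAddCommGroup H] {T : ℝ}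

namespace CompleteRadonMeasure

variable (ν : CompleteRadonMeasure T)

theorem measurableSpace_le : (inferInstance : MeasurableSpace (Icc (0 : ℝ) T)) ≤ ν.sigma := by
  rw [BorelSpace.measurable_eq (α := Icc (0 : ℝ) T)]
  exact ν.borel_le

theorem opensMeasurableSpace : @OpensMeasurableSpace (Icc (0 : ℝ) T) _ ν.sigma :=
  @OpensMeasurableSpace.mk _ _ ν.sigma ν.borel_le

theorem isFiniteMeasure : IsFiniteMeasure ν.meas := ⟨ν.finite⟩

theorem measureInnerRegular : @Measure.InnerRegular _ ν.sigma _ ν.meas :=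
  @Measure.InnerRegular.mk _ ν.sigma _ _ ν.innerRegular

/-- The restriction of a complete Radon measure to the Borel sets. -/
def borelMeas : Measure (Icc (0 : ℝ) T) := ν.meas.trim ν.measurableSpace_le

instance : IsFiniteMeasure ν.borelMeas :=
  have := ν.isFiniteMeasure
  isFiniteMeasure_trim _

/-- Two reference measures may live on different σ-algebras; this allows them to be compared on the
Borel sets. -/
theorem ae_borelMeas_iff {P : Icc (0 : ℝ) T → Prop} :
    (∀ᵐ t ∂ν.borelMeas, P t) ↔ ∀ᵐ t ∂ν.meas, P t :=
  ⟨fun h => ae_of_ae_trim ν.measurableSpace_le h, fun h =>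
    @ae_trim_of_ae _ _ ν.sigma _ _ ν.opensMeasurableSpace _ ν.isFiniteMeasure ν.measureInnerRegular
      (BorelSpace.measurable_eq (α := Icc (0 : ℝ) T)) ν.measurableSpace_le _ h⟩

end CompleteRadonMeasure

variable [InnerProductSpace ℝ H] [CompleteSpace H] {m : VectorMeasure (Icc (0 : ℝ) T) H}
  {μ ν : CompleteRadonMeasure T}

theorem AbsCont.variation_absolutelyContinuous (h : AbsCont m ν) :
    m.variation ≪ ν.borelMeas := by
  refine Measure.AbsolutelyContinuous.mk fun s hs h0 => ?_
  rw [CompleteRadonMeasure.borelMeas, trim_measurableSet_eq ν.measurableSpace_le hs] at h0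
  exact (VectorMeasure.variation_apply_eq_zero hs).2 fun t hts ht =>
    h t ht (measure_mono_null hts h0)

theorem IsDensity.ae_eq {v w : Icc (0 : ℝ) T → H} (hv : IsDensity m ν v) (hw : IsDensity m ν w) :
    v =ᵐ[ν.meas] w := by
  refine @ae_eq_of_forall_borel_setIntegral_eq _ _ _ ν.sigma ν.opensMeasurableSpace _
    ν.isFiniteMeasure ν.measureInnerRegular _ _ _ _ _ _ hv.1 hw.1 fun B hB => ?_
  rw [← BorelSpace.measurable_eq (α := Icc (0 : ℝ) T)] at hB
  rw [← hv.2 B hB, ← hw.2 B hB]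

/-- The densities of a vector measure of finite variation with respect to all complete Radon
measures are multiples of one function. -/
theorem exists_isDensity_rnDeriv_smul (m : VectorMeasure (Icc (0 : ℝ) T) H)
    [IsFiniteMeasure m.variation] : ∃ g : Icc (0 : ℝ) T → H, ∀ ν : CompleteRadonMeasure T,
      AbsCont m ν → IsDensity m ν fun t => (m.variation.rnDeriv ν.borelMeas t).toReal • g t := by
  obtain ⟨g, hgm, hgi, hg⟩ := exists_density_variation m
  refine ⟨g, fun ν hν => ?_⟩
  have hac := hν.variation_absolutelyContinuous
  have hsm : StronglyMeasurable fun t => (m.variation.rnDeriv ν.borelMeas t).toReal • g t :=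
    (Measure.measurable_rnDeriv _ _).ennreal_toReal.stronglyMeasurable.smul hgm
  refine ⟨integrable_of_integrable_trim ν.measurableSpace_le
    ((integrable_rnDeriv_smul_iff hac).2 hgi), fun B hB => ?_⟩
  rw [setIntegral_trim ν.measurableSpace_le hsm hB, hg B hB]
  exact (setIntegral_rnDeriv_smul hac hB).symm

theorem AbsCont.isDensity_density [IsFiniteMeasure m.variation] (h : AbsCont m ν) :
    IsDensity m ν (density m ν) := by
  obtain ⟨g, hg⟩ := exists_isDensity_rnDeriv_smul m
  have hex : ∃ v, IsDensity m ν v := ⟨_, hg ν h⟩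
  rw [density, dif_pos hex]
  exact hex.choose_spec

/-- The inclusion of the density in a cone does not depend on the reference measure. -/
theorem ae_neg_density_mem_of_cone [IsFiniteMeasure m.variation] {N : Icc (0 : ℝ) T → Set H}
    (hN0 : ∀ t, 0 ∈ N t) (hN : ∀ t, ∀ a : ℝ, 0 ≤ a → ∀ ζ ∈ N t, a • ζ ∈ N t)
    {v w : Icc (0 : ℝ) T → H} (hμ : AbsCont m μ) (hv : IsDensity m μ v) (hν : AbsCont m ν)
    (hw : IsDensity m ν w) (h : ∀ᵐ t ∂μ.meas, -v t ∈ N t) : ∀ᵐ t ∂ν.meas, -w t ∈ N t := by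
  obtain ⟨g, hg⟩ := exists_isDensity_rnDeriv_smul m
  -- A |m|-a.e. statement is one that holds μ-a.e. where d|m|/dμ is nonzero; there one may divide by
  -- the derivative.
  have hgN : ∀ᵐ t ∂m.variation, -g t ∈ N t := by
    rw [← Measure.withDensity_rnDeriv_eq _ _ hμ.variation_absolutelyContinuous,
      ae_withDensity_iff (Measure.measurable_rnDeriv _ _)]
    filter_upwards [μ.ae_borelMeas_iff.2 h, μ.ae_borelMeas_iff.2 (hv.ae_eq (hg μ hμ)),
      Measure.rnDeriv_lt_top m.variation μ.borelMeas] with t ht hvt hlt hne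
    have hpos : 0 < (m.variation.rnDeriv μ.borelMeas t).toReal := ENNReal.toReal_pos hne hlt.ne
    have := hN t _ (inv_nonneg.2 hpos.le) _ ht
    rwa [hvt, smul_neg, inv_smul_smul₀ hpos.ne'] at this
  rw [← Measure.withDensity_rnDeriv_eq _ _ hν.variation_absolutelyContinuous,
    ae_withDensity_iff (Measure.measurable_rnDeriv _ _), ν.ae_borelMeas_iff] at hgN
  filter_upwards [hgN, hw.ae_eq (hg ν hν)] with t ht hwt
  rw [hwt, ← smul_neg]
  -- Where d|m|/dν vanishes nothing is known of `g`, but the density is 0.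
  by_cases h0 : m.variation.rnDeriv ν.borelMeas t = 0
  · simpa [h0] using hN0 t
  · exact hN t _ ENNReal.toReal_nonneg _ (ht h0)

end Densities

/-! ### The residual and the variational inequality -/

section Residual

variable {H : Type*} [NormedAddCommGroup H] [InnerProductSpace ℝ H] {T : ℝ}
  {ρ : ℝ≥0∞} {C : Icc (0 : ℝ) T → Set H} {ν : CompleteRadonMeasure T} {x₀ : H}
  {x v : Icc (0 : ℝ) T → H}

theorem residualIntegral_nonneg (hC : ∀ t, IsProxRegular ρ (C t)) (hxC : ∀ t, x t ∈ C t)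
    (hv : ∀ᵐ t ∂ν.meas, -v t ∈ proxNormalCone (C t) (x t)) {y : C(Icc (0 : ℝ) T, H)}
    (hy : y ∈ testClass C ν) : 0 ≤ residualIntegral ρ ν v x y := by
  refine integral_nonneg_of_ae ?_
  filter_upwards [hv, hy] with t ht hyt
  exact (hC t).proxGap_nonneg (hxC t) hyt ht

theorem IsAdmissible.exists_norm_le (hT : 0 ≤ T) (hx : IsAdmissible C x₀ x) :
    ∃ M, ∀ t, ‖x t‖ ≤ M := by
  let o : Icc (0 : ℝ) T := ⟨0, le_rfl, hT⟩
  refine ⟨‖x o‖ + (eVariationOn x univ).toReal, fun t => ?_⟩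
  have := hx.bv.dist_le (mem_univ t) (mem_univ o)
  rw [dist_eq_norm] at this
  linarith [norm_le_norm_add_norm_sub' (x t) (x o)]

/-- (H3) on the compact set `{t}`, with η large enough to reach `z`. -/
theorem AssumptionH3.exists_selection (hC : AssumptionH3 C) (hT : 0 ≤ T)
    (hx : IsAdmissible C x₀ x) {t : Icc (0 : ℝ) T} {z : H} (hz : z ∈ C t) :
    ∃ y : C(Icc (0 : ℝ) T, H), (∀ s, y s ∈ C s) ∧ y t = z := by
  obtain ⟨R, -, hR⟩ := hC x (hx.exists_norm_le hT) hx.mem (‖z - x t‖ + 1) (by positivity)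
  obtain ⟨y, hyC, hy, -⟩ := hR {t} (fun _ => z) isCompact_singleton continuousOn_const
    (by simpa using hz) (by simp)
  exact ⟨y, hyC, hy t rfl⟩

theorem exists_selection_residualIntegral_close (hC : AssumptionH3 C) (hT : 0 ≤ T)
    (hx : IsAdmissible C x₀ x) (hv : Integrable v ν.meas) (y : C(Icc (0 : ℝ) T, H))
    (hy : ∀ t, y t ∈ C t) {B : Set (Icc (0 : ℝ) T)} (hB : MeasurableSet[ν.sigma] B) {ε : ℝ}
    (hε : 0 < ε) : ∃ ybar : C(Icc (0 : ℝ) T, H), (∀ t, ybar t ∈ C t) ∧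
      |residualIntegral ρ ν v x ybar -
        ∫ t in B, proxGap (halfInv ρ) (v t) (y t - x t) ∂ν.meas| ≤ ε := by
  obtain ⟨M, hM⟩ := hx.exists_norm_le hT
  exact @exists_selection_integral_proxGap_close _ _ _ _ ν.sigma ν.opensMeasurableSpace _
    ν.isFiniteMeasure _ _ _ ν.measureInnerRegular C x
    ((stronglyMeasurable_of_rightCont hT hx.rightCont).mono ν.measurableSpace_le) M hM hx.mem
    (hC x ⟨M, hM⟩ hx.mem) _ (halfInv_nonneg ρ) v hv y hy B hB ε hε

/-- The residual integrals over continuous selections have infimum at most zero. -/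
theorem exists_selection_residualIntegral_le (hC : AssumptionH3 C) (hT : 0 ≤ T)
    (hx : IsAdmissible C x₀ x) (hv : Integrable v ν.meas) {ε : ℝ} (hε : 0 < ε) :
    ∃ y : C(Icc (0 : ℝ) T, H), (∀ t, y t ∈ C t) ∧ residualIntegral ρ ν v x y ≤ ε := by
  obtain ⟨y, hy, -⟩ := hC.exists_selection hT hx (hx.mem ⟨0, le_rfl, hT⟩)
  -- With `B` empty, `ybar` approximates `x` itself, whose gap is 0; `y` plays no role.
  obtain ⟨ybar, hybar, h⟩ := exists_selection_residualIntegral_close (ρ := ρ) hC hT hx hv y hy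
    (@MeasurableSet.empty _ ν.sigma) hε
  refine ⟨ybar, hybar, (le_abs_self _).trans ?_⟩
  rwa [setIntegral_empty, sub_zero] at h

/-- The variational inequality on continuous selections gives the pointwise inclusion of the
density in the opposite of the proximal normal cone. -/
theorem ae_neg_mem_proxNormalCone [CompleteSpace H] (hC : AssumptionH3 C) (hT : 0 ≤ T)
    (hx : IsAdmissible C x₀ x) (hv : Integrable v ν.meas)
    (h : ∀ y : C(Icc (0 : ℝ) T, H), (∀ t, y t ∈ C t) → 0 ≤ residualIntegral ρ ν v x y) :
    ∀ᵐ t ∂ν.meas, -v t ∈ proxNormalCone (C t) (x t) := by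
  have hxm := (stronglyMeasurable_of_rightCont hT hx.rightCont).mono ν.measurableSpace_le
  obtain ⟨M, hM⟩ := hx.exists_norm_le hT
  have key (y : C(Icc (0 : ℝ) T, H)) (hy : y ∈ {y : C(Icc (0 : ℝ) T, H) | ∀ t, y t ∈ C t}) :
      ∀ᵐ t ∂ν.meas, 0 ≤ proxGap (halfInv ρ) (v t) (y t - x t) := by
    have hyx (t : Icc (0 : ℝ) T) : ‖y t - x t‖ ≤ ‖y‖ + M :=
      (norm_sub_le _ _).trans (add_le_add (y.norm_coe_le_norm t) (hM t))
    have hym := @stronglyMeasurable_continuousMap _ _ _ _ ν.sigma ν.opensMeasurableSpace _ _ _ y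
    -- The integral over `B` is within ε of a residual integral, which is nonnegative.
    refine ae_nonneg_of_forall_setIntegral_nonneg
      (integrable_proxGap (halfInv_nonneg ρ) hv (hym.sub hxm).aestronglyMeasurable hyx)
      fun B hB _ => le_of_forall_pos_le_add fun ε hε => ?_
    obtain ⟨ybar, hybar, hle⟩ :=
      exists_selection_residualIntegral_close (ρ := ρ) hC hT hx hv y hy hB hε
    have := h ybar hybar
    have := (abs_le.1 hle).2
    change 0 ≤ ∫ t in B, proxGap (halfInv ρ) (v t) (y t - x t) ∂ν.meas + ε
    linarith
  have := @ae_forall_proxGap_nonneg _ _ _ _ ν.sigma ν.opensMeasurableSpace ν.meas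
    ν.isFiniteMeasure _ _ _ _ _ C x hxm {y | ∀ t, y t ∈ C t}
    (fun t z hz => hC.exists_selection hT hx hz) (halfInv ρ) v hv.aestronglyMeasurable key
  filter_upwards [this] with t ht
  exact neg_mem_proxNormalCone_of_proxGap_nonneg (halfInv_nonneg ρ) (hx.mem t) ht

variable [CompleteSpace H]

theorem le_residual_iff (hx : BoundedVariationOn x univ) {a : ℝ} :
    (a : EReal) ≤ residual ρ C ν hx ↔ ∀ y ∈ testClass C ν,
      a ≤ residualIntegral ρ ν (density (differentialMeasure hx) ν) x y := by
  simp [residual]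

theorem residual_nonpos (hC : AssumptionH3 C) (hT : 0 ≤ T) (hx : IsAdmissible C x₀ x)
    (hv : Integrable (density (differentialMeasure hx.bv) ν) ν.meas) :
    residual ρ C ν hx.bv ≤ 0 := by
  refine le_of_not_gt fun hlt => ?_
  obtain ⟨a, ha0, ha⟩ := EReal.lt_iff_exists_real_btwn.1 hlt
  have ha0 : 0 < a := EReal.coe_pos.1 ha0
  obtain ⟨y, hyC, hy⟩ :=
    exists_selection_residualIntegral_le (ρ := ρ) hC hT hx hv (half_pos ha0)
  linarith [(le_residual_iff hx.bv).1 ha.le y (ae_of_all _ hyC)]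

end Residual

end SweepingProcess

end

/-! ### The equivalence -/

theorem theorem5p1 {H : Type*} [NormedAddCommGroup H] [InnerProductSpace ℝ H] [CompleteSpace H]
    (T : ℝ) (hT : 0 < T) (ρ : ℝ≥0∞) (hρ : 0 < ρ)
    (C : Icc (0 : ℝ) T → Set H)
    (hC₁ : SweepingProcess.AssumptionH1 ρ C)
    (hC₂ : SweepingProcess.AssumptionH2 C)
    (hC₃ : SweepingProcess.AssumptionH3 C)
    (x₀ : H) (x : Icc (0 : ℝ) T → H) (hx : SweepingProcess.IsAdmissible C x₀ x)
    (ν : SweepingProcess.CompleteRadonMeasure T)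
    (hν : SweepingProcess.AbsCont (SweepingProcess.differentialMeasure hx.bv) ν) :
    SweepingProcess.IsDensity (SweepingProcess.differentialMeasure hx.bv) ν
        (SweepingProcess.density (SweepingProcess.differentialMeasure hx.bv) ν) ∧
    (SweepingProcess.testClass C ν).Nonempty ∧
    SweepingProcess.residual ρ C ν hx.bv ≤ 0 ∧
    List.TFAE [
      SweepingProcess.IsIntegralSolution ρ C x₀ x,
      SweepingProcess.IsDifferentialMeasureSolution C x₀ x,
      SweepingProcess.residual ρ C ν hx.bv = 0,
      ∃ ν' : SweepingProcess.CompleteRadonMeasure T,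
        SweepingProcess.AbsCont (SweepingProcess.differentialMeasure hx.bv) ν' ∧
        SweepingProcess.residual ρ C ν' hx.bv = 0] := by
  open SweepingProcess in
  have := isFiniteMeasure_variation_differentialMeasure hT.le hx.bv hx.rightCont
  have hdens := hν.isDensity_density
  have hle : residual ρ C ν hx.bv ≤ 0 := residual_nonpos hC₃ hT.le hx hdens.1
  refine ⟨hdens, ?_, hle, ?_⟩
  · obtain ⟨y, hy, -⟩ := hC₃.exists_selection hT.le hx (hx.mem ⟨0, le_rfl, hT.le⟩)
    exact ⟨y, ae_of_all _ hy⟩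
  tfae_have 1 → 2 := by
    rintro ⟨hx', μ, v, hμ, hv, h⟩
    exact ⟨hx', μ, v, hμ, hv, ae_neg_mem_proxNormalCone hC₃ hT.le hx' hv.1
      fun y hy => h y (Filter.Eventually.of_forall hy)⟩
  tfae_have 2 → 3 := by
    rintro ⟨_, μ, v, hμ, hv, h⟩
    refine le_antisymm hle ((le_residual_iff hx.bv).2 fun y hy => ?_)
    refine residualIntegral_nonneg (fun t => (hC₁ t).2.2.2) hx.mem ?_ hy
    -- The solution comes with its own measure `μ`; the inclusion is moved to the given `ν`.
    exact ae_neg_density_mem_of_cone (fun t => zero_mem_proxNormalCone (hx.mem t))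
      (fun t a ha ζ hζ => smul_mem_proxNormalCone ha hζ) hμ hv hν hdens h
  tfae_have 3 → 4 := fun h => ⟨ν, hν, h⟩
  tfae_have 4 → 1 := by
    rintro ⟨ν', hν', h⟩
    exact ⟨hx, ν', _, hν', hν'.isDensity_density, (le_residual_iff hx.bv).1 h.ge⟩
  tfae_finish
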